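/- Fix $p\in[1,\infty]$. For $c\in\mathbb R$ and $r\ge 0$, the axis-centered circle with center $(c,0)$ and radius $r$ encloses the points $q\in\mathbb R^2$ with $\|q-(c,0)\|_p\le r$; a finite family of such circles covers a family of clients if every client is enclosed by at least one circle of the family. The model of computation is a real RAM: a fixed program with natural-number and exact real variables and arrays, in which each of the following takes one step: accessing a variable or an array entry (at a computed index), comparing two numbers, adding, subtracting or halving natural numbers, the four arithmetic operations on real numbers, and the two primitives of constant size that the metric requires, namely evaluating the $L_p$ length of a vector in the plane, and computing, for two given points, the center of the circle pinned by them, that is, of the leftmost among the smallest axis-centered circles passing through both (with value $0$ if there is none). Theorem. For every fixed $p\in[1,\infty]$ there is a program for this real RAM that, given any $n\ge 0$ clients in the plane, computes in $O(n^2\log n)$ steps (in $O(1)$ steps if $n\le 1$) the centers and radii of a finite family of axis-centered circles that covers the clients and whose sum of radii is minimum among all finite families of axis-centered circles that cover the clients. The implied constants depend only on $p$. -/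

import Mathlib

open scoped ENNReal

namespace AxisCover

/-! ### Circles centered on the x-axis in the `L_p` plane

The plane with the `L_p` metric, `1 ≤ p ≤ ∞`, is Mathlib's `WithLp p (ℝ × ℝ)`. -/

section Geometry

variable (p : ℝ≥0∞) [Fact (1 ≤ p)]

/-- The circles with centers `(c j, 0)` and radii `r j ≥ 0` (zero is allowed), `j < k`,
enclose all the clients `Y i`. -/
def IsCover {n k : ℕ} (Y : Fin n → ℝ × ℝ) (c r : Fin k → ℝ) : Prop :=
  (∀ j, 0 ≤ r j) ∧
    ∀ i, ∃ j, WithLp.toLp p (Y i) ∈ Metric.closedBall (WithLp.toLp p (c j, (0 : ℝ))) (r j)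

/-- A cover whose sum of radii is at most that of every cover, by any finite number of circles. -/
def IsOptimalCover {n k : ℕ} (Y : Fin n → ℝ × ℝ) (c r : Fin k → ℝ) : Prop :=
  IsCover p Y c r ∧
    ∀ (m : ℕ) (c' r' : Fin m → ℝ), IsCover p Y c' r' → ∑ j, r j ≤ ∑ j, r' j

/-- The axis-centered circle with center `(c, 0)` and radius `r` passes through `q` and `q'`. -/
def PassesThrough (q q' : ℝ × ℝ) (c r : ℝ) : Prop :=
  WithLp.toLp p q ∈ Metric.sphere (WithLp.toLp p (c, (0 : ℝ))) r ∧
    WithLp.toLp p q' ∈ Metric.sphere (WithLp.toLp p (c, (0 : ℝ))) r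

/-- The circle is pinned by `q` and `q'`: it is the leftmost among the smallest axis-centered
circles through both points. With `q = q'` this is the circle pinned by a single point. -/
def IsPinned (q q' : ℝ × ℝ) (c r : ℝ) : Prop :=
  PassesThrough p q q' c r ∧
    ∀ c' r', PassesThrough p q q' c' r' → r < r' ∨ (r = r' ∧ c ≤ c')

open Classical in
/-- The abscissa of the center of the circle pinned by `q` and `q'`
(`0` if no axis-centered circle passes through both points). -/
noncomputable def pinnedCenter (q q' : ℝ × ℝ) : ℝ :=
  if h : ∃ c, ∃ r, IsPinned p q q' c r then h.choose else 0

end Geometry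

/-! ### A real RAM

A program is a finite text. Its memory consists of cells that hold
natural numbers (used for counting and addressing) or exact real numbers; cells are organized
as simple variables and as arrays, which are indexed by computed natural numbers. Variables and
arrays are named by numerals fixed in the program text. -/

/-- Natural-number expressions: numerals, variables, array entries, addition, truncated
subtraction, halving (rounded down). -/
inductive NExp : Type
  | lit (k : ℕ)
  | var (x : ℕ)
  | get (a : ℕ) (e : NExp)
  | add (e f : NExp)
  | sub (e f : NExp)
  | half (e : NExp)

/-- Real expressions: numerals, variables, array entries, the four arithmetic operations,
and two geometric primitives of constant size, the `L_p` length of a vector and the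
center of the circle pinned by two points. -/
inductive RExp : Type
  | lit (k : ℕ)
  | var (x : ℕ)
  | get (a : ℕ) (e : NExp)
  | add (e f : RExp)
  | sub (e f : RExp)
  | mul (e f : RExp)
  | div (e f : RExp)
  | len (e f : RExp)
  | pinned (e₁ e₂ f₁ f₂ : RExp)

/-- Tests: strict comparison of natural numbers or of reals, negation, conjunction. -/
inductive Test : Type
  | nlt (e f : NExp)
  | rlt (e f : RExp)
  | neg (b : Test)
  | conj (b d : Test)

/-- Programs. -/
inductive Prog : Type
  | skip
  | nset (x : ℕ) (e : NExp)
  | rset (x : ℕ) (e : RExp)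
  | nput (a : ℕ) (i : NExp) (e : NExp)
  | rput (a : ℕ) (i : NExp) (e : RExp)
  | seq (P Q : Prog)
  | cond (b : Test) (P Q : Prog)
  | loop (b : Test) (P : Prog)

/-- The memory. -/
structure Store : Type where
  nvar : ℕ → ℕ
  rvar : ℕ → ℝ
  narr : ℕ → ℕ → ℕ
  rarr : ℕ → ℕ → ℝ

def NExp.eval (σ : Store) : NExp → ℕ
  | .lit k => k
  | .var x => σ.nvar x
  | .get a e => σ.narr a (e.eval σ)
  | .add e f => e.eval σ + f.eval σ
  | .sub e f => e.eval σ - f.eval σ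
  | .half e => e.eval σ / 2

/-- Number of elementary operations in the evaluation of an expression. -/
def NExp.cost : NExp → ℕ
  | .lit _ => 1
  | .var _ => 1
  | .get _ e => e.cost + 1
  | .add e f => e.cost + f.cost + 1
  | .sub e f => e.cost + f.cost + 1
  | .half e => e.cost + 1

noncomputable def RExp.eval (p : ℝ≥0∞) [Fact (1 ≤ p)] (σ : Store) : RExp → ℝ
  | .lit k => (k : ℝ)
  | .var x => σ.rvar x
  | .get a e => σ.rarr a (e.eval σ)
  | .add e f => e.eval p σ + f.eval p σ
  | .sub e f => e.eval p σ - f.eval p σ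
  | .mul e f => e.eval p σ * f.eval p σ
  | .div e f => e.eval p σ / f.eval p σ
  | .len e f => ‖WithLp.toLp p (e.eval p σ, f.eval p σ)‖
  | .pinned e₁ e₂ f₁ f₂ =>
      pinnedCenter p (e₁.eval p σ, e₂.eval p σ) (f₁.eval p σ, f₂.eval p σ)

/-- Number of elementary operations in the evaluation of an expression. -/
def RExp.cost : RExp → ℕ
  | .lit _ => 1
  | .var _ => 1
  | .get _ e => e.cost + 1
  | .add e f => e.cost + f.cost + 1
  | .sub e f => e.cost + f.cost + 1
  | .mul e f => e.cost + f.cost + 1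
  | .div e f => e.cost + f.cost + 1
  | .len e f => e.cost + f.cost + 1
  | .pinned e₁ e₂ f₁ f₂ => e₁.cost + e₂.cost + f₁.cost + f₂.cost + 1

def Test.holds (p : ℝ≥0∞) [Fact (1 ≤ p)] (σ : Store) : Test → Prop
  | .nlt e f => e.eval σ < f.eval σ
  | .rlt e f => e.eval p σ < f.eval p σ
  | .neg b => ¬ b.holds p σ
  | .conj b d => b.holds p σ ∧ d.holds p σ

/-- Number of elementary operations in the evaluation of a test. -/
def Test.cost : Test → ℕ
  | .nlt e f => e.cost + f.cost + 1
  | .rlt e f => e.cost + f.cost + 1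
  | .neg b => b.cost + 1
  | .conj b d => b.cost + d.cost + 1

def Store.nset (σ : Store) (x v : ℕ) : Store :=
  { σ with nvar := Function.update σ.nvar x v }

def Store.rset (σ : Store) (x : ℕ) (v : ℝ) : Store :=
  { σ with rvar := Function.update σ.rvar x v }

def Store.nput (σ : Store) (a i v : ℕ) : Store :=
  { σ with narr := Function.update σ.narr a (Function.update (σ.narr a) i v) }

def Store.rput (σ : Store) (a i : ℕ) (v : ℝ) : Store :=
  { σ with rarr := Function.update σ.rarr a (Function.update (σ.rarr a) i v) }

/-- `Exec p P σ τ t`: started in memory `σ`, the program `P` halts in memory `τ` after exactly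
`t` steps. -/
inductive Exec (p : ℝ≥0∞) [Fact (1 ≤ p)] : Prog → Store → Store → ℕ → Prop
  | skip (σ : Store) : Exec p .skip σ σ 1
  | nset (x : ℕ) (e : NExp) (σ : Store) :
      Exec p (.nset x e) σ (σ.nset x (e.eval σ)) (e.cost + 1)
  | rset (x : ℕ) (e : RExp) (σ : Store) :
      Exec p (.rset x e) σ (σ.rset x (e.eval p σ)) (e.cost + 1)
  | nput (a : ℕ) (i e : NExp) (σ : Store) :
      Exec p (.nput a i e) σ (σ.nput a (i.eval σ) (e.eval σ)) (i.cost + e.cost + 1)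
  | rput (a : ℕ) (i : NExp) (e : RExp) (σ : Store) :
      Exec p (.rput a i e) σ (σ.rput a (i.eval σ) (e.eval p σ)) (i.cost + e.cost + 1)
  | seq {P Q : Prog} {σ τ υ : Store} {s t : ℕ} :
      Exec p P σ τ s → Exec p Q τ υ t → Exec p (.seq P Q) σ υ (s + t)
  | condTrue {b : Test} {P Q : Prog} {σ τ : Store} {t : ℕ} :
      b.holds p σ → Exec p P σ τ t → Exec p (.cond b P Q) σ τ (b.cost + t)
  | condFalse {b : Test} {P Q : Prog} {σ τ : Store} {t : ℕ} :
      ¬ b.holds p σ → Exec p Q σ τ t → Exec p (.cond b P Q) σ τ (b.cost + t)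
  | loopDone {b : Test} {P : Prog} {σ : Store} :
      ¬ b.holds p σ → Exec p (.loop b P) σ σ b.cost
  | loopStep {b : Test} {P : Prog} {σ τ υ : Store} {s t : ℕ} :
      b.holds p σ → Exec p P σ τ s → Exec p (.loop b P) τ υ t →
        Exec p (.loop b P) σ υ (b.cost + s + t)

/-- The initial memory: the natural variable `0` holds the number `n` of clients, the real
arrays `0` and `1` hold their abscissas and ordinates, everything else is `0`. -/
def inputStore {n : ℕ} (Y : Fin n → ℝ × ℝ) : Store where
  nvar x := if x = 0 then n else 0
  rvar _ := 0
  narr _ _ := 0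
  rarr a i :=
    if h : i < n then
      if a = 0 then (Y ⟨i, h⟩).1 else if a = 1 then (Y ⟨i, h⟩).2 else 0
    else 0

/-- The number of circles in the output, read from the natural variable `1`. -/
def Store.outCount (σ : Store) : ℕ := σ.nvar 1

/-- The abscissas of the centers in the output, read from the real array `2`. -/
def Store.outCenter (σ : Store) (j : Fin σ.outCount) : ℝ := σ.rarr 2 j

/-- The radii in the output, read from the real array `3`. -/
def Store.outRadius (σ : Store) (j : Fin σ.outCount) : ℝ := σ.rarr 3 j

end AxisCover

namespace AxisCover

/-! ### Lexicographically least points of convex upper sets -/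

/-! Two axis-centered circles with overlapping traces on the axis fit into one circle whose radius
is at most the sum of theirs (`exists_merge`). So, once the clients are sorted by abscissa, no cover
is cheaper than the best one that cuts the sequence into contiguous ranges and gives each range its
own circle (`le_sum_radii`). The optimum then obeys D n = 0 and D i = min over e of (least radius
for i, …, e) + D (e + 1).

There are quadratically many ranges, so each least circle has to be found in constant time. View a
circle as a point (c, r): the circles enclosing a client form the epigraph of a convex function, a
convex and upward closed set. Comparing r first and c second makes the least circle unique; the
tie-break matters for p = ∞. For three such sets, the largest of the three pairwise least points
lies in all three, a Helly-type fact (`LexLeast.mem_of_lexLe`, `LexLeast.of_pairs`). Applied to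
client i, client e + 1 and the clients in between, it shows that the least circle for i, …, e + 1 is
the one for i, …, e, or the one for i + 1, …, e + 1, or the circle pinned by the two end clients
(`lexLeast_enclosingRange`).

The program sorts by exchanges, fills the tables for decreasing i, and follows the recorded choices.
Loop invariants (`SortInv`, `RowInv`, `ColInv`, `EmitInv`) give correctness. The running time is
quadratic even without the logarithm. -/

/-- Among the points `(c, r)` of `A`, the smallest `r`, and for it the smallest `c`. -/
def LexLeast (A : Set (ℝ × ℝ)) (c r : ℝ) : Prop :=
  (c, r) ∈ A ∧ ∀ c' r', (c', r') ∈ A → r < r' ∨ (r = r' ∧ c ≤ c')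

/-- Upward closed in the second coordinate. -/
def UpClosed (A : Set (ℝ × ℝ)) : Prop :=
  ∀ c r r', (c, r) ∈ A → r ≤ r' → (c, r') ∈ A

/-- Lexicographic comparison, second coordinates first. -/
def LexLe (u v : ℝ × ℝ) : Prop := u.2 < v.2 ∨ (u.2 = v.2 ∧ u.1 ≤ v.1)

theorem LexLe.total (u v : ℝ × ℝ) : LexLe u v ∨ LexLe v u := by
  unfold LexLe; grind

theorem LexLe.trans {u v w : ℝ × ℝ} (h : LexLe u v) (h' : LexLe v w) : LexLe u w := by
  unfold LexLe at *; grind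

theorem LexLe.snd_le {u v : ℝ × ℝ} (h : LexLe u v) : u.2 ≤ v.2 := by
  unfold LexLe at h; grind

theorem LexLeast.mono {A B : Set (ℝ × ℝ)} {c r : ℝ} (h : LexLeast A c r) (hBA : B ⊆ A)
    (hB : (c, r) ∈ B) : LexLeast B c r :=
  ⟨hB, fun c' r' h' => h.2 c' r' (hBA h')⟩

/-- The segment from `(C, R)` to `(c₂, r₂)` has a point above `c₁`. As `c₁ ≠ C`, it gives positive
weight to the second endpoint, which preserves a strict drop in height. -/
theorem exists_mem_between {B : Set (ℝ × ℝ)} (hB : Convex ℝ B) {C R c₁ c₂ r₂ : ℝ}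
    (hw : (C, R) ∈ B) (hv : (c₂, r₂) ∈ B) (hne : c₁ ≠ C) (hr : r₂ ≤ R)
    (hbt : (c₂ ≤ c₁ ∧ c₁ ≤ C) ∨ (C ≤ c₁ ∧ c₁ ≤ c₂)) :
    ∃ r, (c₁, r) ∈ B ∧ r ≤ R ∧ (r₂ < R → r < R) := by
  have hne' : c₂ - C ≠ 0 := by grind
  set t := (c₁ - C) / (c₂ - C) with ht
  have htc : t * (c₂ - C) = c₁ - C := by rw [ht]; field_simp
  have ht0 : 0 < t := by
    rcases hbt with h | h
    · exact div_pos_of_neg_of_neg (by grind) (by grind)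
    · exact div_pos (by grind) (by grind)
  have ht1 : t ≤ 1 := by
    rcases hbt with h | h
    · exact (div_le_one_of_neg (by grind)).2 (by grind)
    · exact (div_le_one (by grind)).2 (by grind)
  have := hB hw hv (a := 1 - t) (b := t) (by linarith) ht0.le (by ring)
  refine ⟨(1 - t) * R + t * r₂, ?_, by nlinarith, fun h => by nlinarith⟩
  convert this using 1
  ext
  · simp; linarith
  · simp

/-- Helly-type core: the largest of three pairwise least points belongs to the third set as well.
The position of the abscissas of `u` and `v` relative to `C` decides the argument. -/
theorem LexLeast.mem_of_lexLe {A B Q : Set (ℝ × ℝ)} (hA : Convex ℝ A) (hB : Convex ℝ B)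
    (hQ : Convex ℝ Q) (uA : UpClosed A) (uB : UpClosed B) (uQ : UpClosed Q) {C R : ℝ}
    (hw : LexLeast (A ∩ B) C R) {u v : ℝ × ℝ} (hu : u ∈ A ∩ Q) (hv : v ∈ B ∩ Q)
    (hur : LexLe u (C, R)) (hvr : LexLe v (C, R)) : (C, R) ∈ Q := by
  by_contra hn
  obtain ⟨c₁, r₁⟩ := u
  obtain ⟨c₂, r₂⟩ := v
  have hr₁ := hur.snd_le
  have hr₂ := hvr.snd_le
  simp only at hr₁ hr₂
  -- A point of `Q` directly below `(C, R)` would already put `(C, R)` into `Q`.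
  have h1 : c₁ ≠ C := by rintro rfl; exact hn (uQ _ _ _ hu.2 hr₁)
  have h2 : c₂ ≠ C := by rintro rfl; exact hn (uQ _ _ _ hv.2 hr₂)
  -- Opposite sides of `C`: raise both points to height `R`; the segment between them passes through
  -- `(C, R)`.
  have hseg : ∀ {a ra b rb}, (a, ra) ∈ Q → (b, rb) ∈ Q → ra ≤ R → rb ≤ R → a < C → C < b →
      False := by
    intro a ra b rb ha hb hra hrb hac hcb
    obtain ⟨r, hr, hrR, -⟩ := exists_mem_between hQ (uQ _ _ _ ha hra) (uQ _ _ _ hb hrb)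
      hac.ne' le_rfl (.inr ⟨hac.le, hcb.le⟩)
    exact hn (uQ _ _ _ hr hrR)
  -- Same side: above the nearer abscissa `c₁` both sets have points of height at most `R`. To the
  -- left of `C` this contradicts minimality at once; to the right, `LexLe` forces both heights
  -- strictly below `R`.
  have key : ∀ {A B : Set (ℝ × ℝ)} {c₁ r₁ c₂ r₂ : ℝ}, Convex ℝ B → UpClosed A → UpClosed B →
      LexLeast (A ∩ B) C R → (c₁, r₁) ∈ A → (c₂, r₂) ∈ B → LexLe (c₁, r₁) (C, R) →
      LexLe (c₂, r₂) (C, R) → c₁ ≠ C →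
      ((c₂ ≤ c₁ ∧ c₁ ≤ C) ∨ (C ≤ c₁ ∧ c₁ ≤ c₂)) → False := by
    intro A B c₁ r₁ c₂ r₂ hB uA uB hw ha hb h1 h2 hne hbt
    obtain ⟨r, hr, hrR, hlt⟩ := exists_mem_between hB hw.1.2 hb hne h2.snd_le hbt
    have := hw.2 c₁ (max r₁ r) ⟨uA _ _ _ ha (le_max_left _ _), uB _ _ _ hr (le_max_right _ _)⟩
    unfold LexLe at h1 h2
    simp only at h1 h2
    grind
  rcases lt_or_gt_of_ne h1 with h1' | h1' <;> rcases lt_or_gt_of_ne h2 with h2' | h2'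
  · rcases le_total c₁ c₂ with h | h
    · exact key hA uB uA (by rwa [Set.inter_comm]) hv.1 hu.1 hvr hur h2 (.inl ⟨h, h2'.le⟩)
    · exact key hB uA uB hw hu.1 hv.1 hur hvr h1 (.inl ⟨h, h1'.le⟩)
  · exact hseg hu.2 hv.2 hr₁ hr₂ h1' h2'
  · exact hseg hv.2 hu.2 hr₂ hr₁ h2' h1'
  · rcases le_total c₁ c₂ with h | h
    · exact key hB uA uB hw hu.1 hv.1 hur hvr h1 (.inr ⟨h1'.le, h⟩)
    · exact key hA uB uA (by rwa [Set.inter_comm]) hv.1 hu.1 hvr hur h2 (.inr ⟨h2'.le, h⟩)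

/-- If the lexicographically least points of `A ∩ Q` and of `B ∩ Q` miss the third set, then the
one of `A ∩ B` lies in `Q`, and is lexicographically above both. -/
theorem LexLeast.of_pairs {A B Q : Set (ℝ × ℝ)} (hA : Convex ℝ A) (hB : Convex ℝ B)
    (hQ : Convex ℝ Q) (uA : UpClosed A) (uB : UpClosed B) (uQ : UpClosed Q)
    {c₁ r₁ c₂ r₂ C R : ℝ} (hv : LexLeast (A ∩ Q) c₁ r₁) (hu : LexLeast (B ∩ Q) c₂ r₂)
    (hw : LexLeast (A ∩ B) C R) (hvB : (c₁, r₁) ∉ B) (huA : (c₂, r₂) ∉ A) :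
    (C, R) ∈ Q ∧ LexLe (c₁, r₁) (C, R) ∧ LexLe (c₂, r₂) (C, R) := by
  -- If `(c₂, r₂)` were the largest of the three, `LexLeast.mem_of_lexLe` would put it into `A`. By
  -- symmetry only `(C, R)` can be the largest.
  have h12 : LexLe (c₁, r₁) (c₂, r₂) → ¬ LexLe (C, R) (c₂, r₂) := fun h h' =>
    huA (LexLeast.mem_of_lexLe hB hQ hA uB uQ uA hu ⟨hw.1.2, hw.1.1⟩
      ⟨hv.1.2, hv.1.1⟩ h' h)
  have h21 : LexLe (c₂, r₂) (c₁, r₁) → ¬ LexLe (C, R) (c₁, r₁) := fun h h' =>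
    hvB (LexLeast.mem_of_lexLe hA hQ hB uA uQ uB hv ⟨hw.1.1, hw.1.2⟩
      ⟨hu.1.2, hu.1.1⟩ h' h)
  have key : LexLe (c₁, r₁) (C, R) ∧ LexLe (c₂, r₂) (C, R) := by
    rcases LexLe.total (c₁, r₁) (c₂, r₂) with h | h
    · have := (LexLe.total (C, R) (c₂, r₂)).resolve_left (h12 h)
      exact ⟨h.trans this, this⟩
    · have := (LexLe.total (C, R) (c₁, r₁)).resolve_left (h21 h)
      exact ⟨this, h.trans this⟩
  exact ⟨hw.mem_of_lexLe hA hB hQ uA uB uQ hv.1 hu.1 key.1 key.2, key⟩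

/-! ### The distance to a point of the axis -/

section Geometry

variable (p : ℝ≥0∞) [Fact (1 ≤ p)]

/-- The distance of `q` to the point `(c, 0)` of the axis. -/
noncomputable def axisDist (q : ℝ × ℝ) (c : ℝ) : ℝ := ‖WithLp.toLp p (q.1 - c, q.2)‖

theorem dist_axis (q : ℝ × ℝ) (c : ℝ) :
    dist (WithLp.toLp p q) (WithLp.toLp p (c, (0 : ℝ))) = axisDist p q c := by
  rw [dist_eq_norm, ← WithLp.toLp_sub, axisDist]
  congr 2
  ext <;> simp

theorem mem_closedBall_axis {q : ℝ × ℝ} {c r : ℝ} :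
    WithLp.toLp p q ∈ Metric.closedBall (WithLp.toLp p (c, (0 : ℝ))) r ↔ axisDist p q c ≤ r := by
  rw [Metric.mem_closedBall, dist_axis]

theorem passesThrough_iff {q q' : ℝ × ℝ} {c r : ℝ} :
    PassesThrough p q q' c r ↔ axisDist p q c = r ∧ axisDist p q' c = r := by
  rw [PassesThrough, Metric.mem_sphere, Metric.mem_sphere, dist_axis, dist_axis]

theorem axisDist_nonneg (q : ℝ × ℝ) (c : ℝ) : 0 ≤ axisDist p q c := norm_nonneg _

theorem abs_sub_le_axisDist (q : ℝ × ℝ) (c : ℝ) : |q.1 - c| ≤ axisDist p q c := by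
  simpa [axisDist] using WithLp.norm_fst_le _ (WithLp.toLp p (q.1 - c, q.2))

/-- Triangle inequality; a horizontal vector has the same length in every `L_p` norm. -/
theorem axisDist_le_add (q : ℝ × ℝ) (c d : ℝ) : axisDist p q d ≤ axisDist p q c + |d - c| := by
  rw [← dist_axis, ← dist_axis]
  refine (dist_triangle _ (WithLp.toLp p (c, (0 : ℝ))) _).trans ?_
  gcongr
  rw [dist_axis, axisDist, WithLp.norm_toLp_fst]
  simp [abs_sub_comm]

theorem convexOn_axisDist (q : ℝ × ℝ) : ConvexOn ℝ Set.univ (axisDist p q) := by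
  refine ⟨convex_univ, fun c _ c' _ a b ha hb hab => ?_⟩
  have : WithLp.toLp p (q.1 - (a • c + b • c'), q.2)
      = a • WithLp.toLp p (q.1 - c, q.2) + b • WithLp.toLp p (q.1 - c', q.2) := by
    rw [← WithLp.toLp_smul, ← WithLp.toLp_smul, ← WithLp.toLp_add]
    congr 1
    ext
    · simp; linear_combination -q.1 * hab
    · simp; linear_combination -q.2 * hab
  unfold axisDist
  rw [this]
  refine (norm_add_le _ _).trans_eq ?_
  rw [norm_smul, norm_smul, Real.norm_of_nonneg ha, Real.norm_of_nonneg hb]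
  rfl

theorem continuous_axisDist (q : ℝ × ℝ) : Continuous (axisDist p q) := by
  refine continuous_norm.comp ((WithLp.prod_continuous_toLp p ℝ ℝ).comp ?_)
  fun_prop

/-- The circles, as pairs of a center and a radius, that enclose `q`. -/
def enclosing (q : ℝ × ℝ) : Set (ℝ × ℝ) := {u | axisDist p q u.1 ≤ u.2}

omit [Fact (1 ≤ p)] in
theorem upClosed_enclosing (q : ℝ × ℝ) : UpClosed (enclosing p q) :=
  fun _ _ _ h h' => le_trans (h : _ ≤ _) h'

theorem convex_enclosing (q : ℝ × ℝ) : Convex ℝ (enclosing p q) := by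
  simpa [enclosing] using (convexOn_axisDist p q).convex_epigraph

/-- The larger of the two distances is continuous in the center with compact sublevel sets, so a
minimum exists, and so does a leftmost minimizer. The case `q = q'` serves a single client. -/
theorem exists_lexLeast_pair (q q' : ℝ × ℝ) :
    ∃ c r, LexLeast (enclosing p q ∩ enclosing p q') c r := by
  let g : ℝ → ℝ := fun c => max (axisDist p q c) (axisDist p q' c)
  have hg : Continuous g := (continuous_axisDist p q).max (continuous_axisDist p q')
  have hsub : ∀ r, {c | g c ≤ r} ⊆ Set.Icc (q.1 - r) (q.1 + r) := fun r c hc => by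
    have := (abs_sub_le_axisDist p q c).trans ((le_max_left _ _).trans hc)
    rw [abs_le] at this
    constructor <;> linarith
  have hcomp : ∀ r, IsCompact {c | g c ≤ r} := fun r =>
    isCompact_Icc.of_isClosed_subset (isClosed_le hg continuous_const) (hsub r)
  obtain ⟨m, hm, hmin⟩ := (hcomp (g 0)).exists_isMinOn ⟨0, le_refl (g 0)⟩ hg.continuousOn
  have hmin' : ∀ c, g m ≤ g c := fun c => by
    rcases le_total (g c) (g 0) with h | h
    · exact hmin h
    · exact (hm : g m ≤ g 0).trans h
  obtain ⟨c, hc, hleast⟩ := (hcomp (g m)).exists_isLeast ⟨m, le_refl (g m)⟩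
  have hc' : g c ≤ g m := hc
  refine ⟨c, g m, max_le_iff.1 hc', ?_⟩
  intro c' r' h'
  have hgr : g c' ≤ r' := max_le h'.1 h'.2
  rcases ((hmin' c').trans hgr).lt_or_eq with h | h
  · exact .inl h
  · exact .inr ⟨h, hleast (show g c' ≤ g m by rw [h]; exact hgr)⟩

/-- The lexicographic order determines the pinned circle uniquely, so the choice in the definition
is harmless. -/
theorem pinnedCenter_eq {q q' : ℝ × ℝ} {c r : ℝ} (h : IsPinned p q q' c r) :
    pinnedCenter p q q' = c := by
  have hex : ∃ c, ∃ r, IsPinned p q q' c r := ⟨c, r, h⟩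
  rw [pinnedCenter, dif_pos hex]
  obtain ⟨r', hr'⟩ := hex.choose_spec
  have h1 := h.2 _ _ hr'.1
  have h2 := hr'.2 _ _ h.1
  grind

theorem LexLeast.isPinned {q q' : ℝ × ℝ} {c r : ℝ}
    (h : LexLeast (enclosing p q ∩ enclosing p q') c r) (hq : axisDist p q c = r)
    (hq' : axisDist p q' c = r) : IsPinned p q q' c r :=
  ⟨(passesThrough_iff p).2 ⟨hq, hq'⟩, fun c' r' h' => by
    rw [passesThrough_iff] at h'
    exact h.2 c' r' ⟨h'.1.le, h'.2.le⟩⟩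

theorem lexLeast_pinnedCenter_self (q : ℝ × ℝ) :
    LexLeast (enclosing p q) (pinnedCenter p q q) (axisDist p q (pinnedCenter p q q)) := by
  obtain ⟨c, r, h⟩ := exists_lexLeast_pair p q q
  have hq : axisDist p q c = r := by
    refine le_antisymm h.1.1 ?_
    have := h.2 c (axisDist p q c) ⟨le_refl (axisDist p q c), le_refl (axisDist p q c)⟩
    grind
  rw [pinnedCenter_eq p (h.isPinned p hq hq), hq]
  simpa using h

/-- If some circle in `B` that does not enclose `q` is lexicographically below the least circle of
`enclosing q ∩ B`, then the latter passes through `q`. -/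
theorem LexLeast.axisDist_eq {q : ℝ × ℝ} {B : Set (ℝ × ℝ)} (hB : Convex ℝ B) {C R : ℝ}
    (hw : LexLeast (enclosing p q ∩ B) C R) {u : ℝ × ℝ} (huB : u ∈ B)
    (hu : u ∉ enclosing p q) (hle : LexLe u (C, R)) : axisDist p q C = R := by
  refine le_antisymm hw.1.1 (le_of_not_gt fun hlt => ?_)
  obtain ⟨c, r⟩ := u
  have hM : r < axisDist p q c := not_le.1 hu
  set δ := R - axisDist p q C with hδ
  set M := axisDist p q c - r with hMd
  have hδ0 : 0 < δ := sub_pos.2 hlt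
  have hM0 : 0 < M := sub_pos.2 hM
  -- `δ` is the slack of `q` at `(C, R)` and `M` its deficit at `u`. Moving the fraction `t` towards
  -- `u` uses up exactly the slack, by convexity, so the new circle still encloses `q` and is
  -- lexicographically smaller.
  set t := δ / (δ + M) with ht
  have ht0 : 0 < t := by positivity
  have ht1 : 0 ≤ 1 - t := by
    rw [ht, sub_nonneg, div_le_one (by positivity)]; linarith
  have htt : (1 - t) * δ = t * M := by rw [ht]; field_simp; ring
  have hmem := hB hw.1.2 huB ht1 ht0.le (by ring)
  have hcv := (convexOn_axisDist p q).2 (Set.mem_univ C) (Set.mem_univ c) ht1 ht0.le (by ring)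
  simp only [smul_eq_mul] at hcv
  have hres := hw.2 ((1 - t) * C + t * c) ((1 - t) * R + t * r)
    ⟨show axisDist p q ((1 - t) * C + t * c) ≤ (1 - t) * R + t * r by
      refine hcv.trans ?_
      rw [hδ, hMd] at htt
      linarith, by simpa using hmem⟩
  have hne : (c, r) ≠ (C, R) := by
    rintro ⟨⟩
    exact hu hw.1.1
  unfold LexLe at hle
  simp only at hle
  rcases hle with h | ⟨h, h'⟩
  · rcases hres with h1 | ⟨h1, -⟩ <;> nlinarith
  · subst h
    have : c < C := lt_of_le_of_ne h' (by rintro rfl; exact hne rfl)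
    rcases hres with h1 | ⟨-, h1⟩
    · nlinarith
    · nlinarith

/-- The circle pinned by `q` and `q'` is the least one that encloses `q`, `q'` and lies in `Q`,
unless the latter is already determined without `q` or without `q'`. -/
theorem lexLeast_pinnedCenter {q q' : ℝ × ℝ} {Q : Set (ℝ × ℝ)} (hQ : Convex ℝ Q)
    (uQ : UpClosed Q) {c₁ r₁ c₂ r₂ : ℝ} (hv : LexLeast (enclosing p q ∩ Q) c₁ r₁)
    (hu : LexLeast (enclosing p q' ∩ Q) c₂ r₂) (hvB : ¬ axisDist p q' c₁ ≤ r₁)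
    (huA : ¬ axisDist p q c₂ ≤ r₂) :
    LexLeast (enclosing p q ∩ enclosing p q' ∩ Q) (pinnedCenter p q q')
      (axisDist p q (pinnedCenter p q q')) := by
  obtain ⟨C, R, hw⟩ := exists_lexLeast_pair p q q'
  obtain ⟨hCQ, h1, h2⟩ := LexLeast.of_pairs (convex_enclosing p q) (convex_enclosing p q') hQ
    (upClosed_enclosing p q) (upClosed_enclosing p q') uQ hv hu hw hvB huA
  have e1 := hw.axisDist_eq p (convex_enclosing p q') hu.1.1 huA h2
  have e2 := LexLeast.axisDist_eq p (convex_enclosing p q) (by rwa [Set.inter_comm])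
    hv.1.1 hvB h1
  rw [pinnedCenter_eq p (hw.isPinned p e1 e2), e1]
  exact hw.mono Set.inter_subset_left ⟨hw.1, hCQ⟩

end Geometry

/-! ### Contiguous covers of sorted points -/

section Partition

variable (p : ℝ≥0∞) [Fact (1 ≤ p)]

/-- Two circles with overlapping traces on the axis lie in one circle whose radius is at most the
sum of theirs. -/
theorem exists_merge (a b : ℝ × ℝ) (hab : |a.1 - b.1| ≤ a.2 + b.2) (ha : 0 ≤ a.2) (hb : 0 ≤ b.2) :
    ∃ d : ℝ × ℝ, d.2 ≤ a.2 + b.2 ∧ ∀ q, axisDist p q a.1 ≤ a.2 ∨ axisDist p q b.1 ≤ b.2 →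
      axisDist p q d.1 ≤ d.2 := by
  -- The new circle has the hull `[L, U]` of both traces as its trace. Containment of traces implies
  -- containment of circles by `axisDist_le_add`.
  set L := min (a.1 - a.2) (b.1 - b.2) with hL
  set U := max (a.1 + a.2) (b.1 + b.2) with hU
  have hsub : ∀ u : ℝ × ℝ, L ≤ u.1 - u.2 → u.1 + u.2 ≤ U → ∀ q, axisDist p q u.1 ≤ u.2 →
      axisDist p q ((L + U) / 2) ≤ (U - L) / 2 := by
    intro u h1 h2 q hq
    refine (axisDist_le_add p q u.1 _).trans ?_
    have : |(L + U) / 2 - u.1| ≤ (U - L) / 2 - u.2 := by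
      rw [abs_le]; constructor <;> linarith
    linarith
  refine ⟨((L + U) / 2, (U - L) / 2), ?_, fun q hq => ?_⟩
  · rw [abs_le] at hab
    simp only
    rcases min_choice (a.1 - a.2) (b.1 - b.2) with h | h <;>
    rcases max_choice (a.1 + a.2) (b.1 + b.2) with h' | h' <;> rw [hL, hU, h, h'] <;> linarith
  · rcases hq with hq | hq
    · exact hsub a (min_le_left _ _) (le_max_left _ _) q hq
    · exact hsub b (min_le_right _ _) (le_max_right _ _) q hq

/-- `D` is a solution of the inequalities `D i ≤ r + D (e + 1)`, for all circles of radius `r`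
enclosing the points `i, …, e` of a sorted sequence. Then `D i` bounds the sum of radii of any
family covering the points from `i` on. -/
theorem le_sum_radii {n : ℕ} {x y : ℕ → ℝ} (hx : ∀ a b, a ≤ b → b < n → x a ≤ x b) {D : ℕ → ℝ}
    (hDn : D n = 0)
    (hD : ∀ i e c r, i ≤ e → e < n → (∀ k, i ≤ k → k ≤ e → axisDist p (x k, y k) c ≤ r) →
      D i ≤ r + D (e + 1))
    (m : ℕ) (F : Multiset (ℝ × ℝ)) (hF : F.card = m) (hr : ∀ u ∈ F, 0 ≤ u.2) (i : ℕ) (hi : i ≤ n)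
    (hcov : ∀ k, i ≤ k → k < n → ∃ u ∈ F, axisDist p (x k, y k) u.1 ≤ u.2) :
    D i ≤ (F.map Prod.snd).sum := by
  -- Induction on the number of circles: each step either removes the circle at the first client or
  -- merges two circles.
  induction m generalizing F i with
  | zero =>
    obtain rfl := Multiset.card_eq_zero.1 hF
    rcases hi.eq_or_lt with rfl | h
    · simp [hDn]
    · simpa using hcov i le_rfl h
  | succ m ih =>
    rcases hi.eq_or_lt with rfl | hin
    · rw [hDn]
      exact Multiset.sum_nonneg (by simpa using fun a b h => hr (b, a) h)
    obtain ⟨u, huF, hu⟩ := hcov i le_rfl hin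
    obtain ⟨F, rfl⟩ := Multiset.exists_cons_of_mem huF
    have hFc : F.card = m := by simpa using hF
    have hu0 := hr u (by simp)
    have hxi := abs_le.1 ((abs_sub_le_axisDist p _ _).trans hu)
    simp only at hxi
    -- `e` is the last client with abscissa within the right end of the trace of `u`; later clients
    -- cannot be enclosed by `u`.
    have hex : ∃ e, i ≤ e ∧ e < n ∧ x e ≤ u.1 + u.2 ∧ ∀ k, e < k → k < n → u.1 + u.2 < x k := by
      classical
      let P : ℕ → Prop := fun e => i ≤ e ∧ e < n ∧ x e ≤ u.1 + u.2
      have hP : P i := ⟨le_rfl, hin, by linarith⟩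
      have := Nat.findGreatest_spec (P := P) hin.le hP
      refine ⟨Nat.findGreatest P n, this.1, this.2.1, this.2.2, fun k hk hkn => ?_⟩
      by_contra hle
      exact Nat.findGreatest_is_greatest hk hkn.le ⟨this.1.trans hk.le, hkn, not_lt.1 hle⟩
    obtain ⟨e, hie, hen, hxe, hlast⟩ := hex
    by_cases hall : ∀ k, i ≤ k → k ≤ e → axisDist p (x k, y k) u.1 ≤ u.2
    · rw [Multiset.map_cons, Multiset.sum_cons]
      refine (hD i e u.1 u.2 hie hen hall).trans ?_
      gcongr
      refine ih F hFc (fun v hv => hr v (by simp [hv])) (e + 1) hen fun k hk hkn => ?_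
      obtain ⟨v, hv, hkv⟩ := hcov k (by omega) hkn
      rcases Multiset.mem_cons.1 hv with rfl | hv
      · have h1 := abs_le.1 ((abs_sub_le_axisDist p _ _).trans hkv)
        have h2 := hlast k hk hkn
        simp only at h1
        linarith
      · exact ⟨v, hv, hkv⟩
    -- A client `k` missed by `u` has `x k` in the trace of `u`, since `x i ≤ x k ≤ x e`, and in the
    -- trace of the circle `v` that encloses it. The traces meet, so `u` and `v` can be merged.
    · push Not at hall
      obtain ⟨k, hik, hke, hk⟩ := hall
      obtain ⟨v, hv, hkv⟩ := hcov k hik (by omega)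
      rcases Multiset.mem_cons.1 hv with rfl | hv
      · exact absurd hkv (not_le.2 hk)
      obtain ⟨F, rfl⟩ := Multiset.exists_cons_of_mem hv
      have hv0 := hr v (by simp)
      have h1 := abs_le.1 ((abs_sub_le_axisDist p _ _).trans hkv)
      have h2 := hx i k hik (by omega)
      have h3 := hx k e hke hen
      simp only at h1
      obtain ⟨d, hd, hcd⟩ := exists_merge p u v
        (by rw [abs_le]; constructor <;> linarith) hu0 hv0
      have hd0 : 0 ≤ d.2 := (axisDist_nonneg p _ _).trans (hcd _ (.inl hu))
      refine (ih (d ::ₘ F) (by simpa using hFc) ?_ i hi ?_).trans ?_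
      · intro w hw
        rcases Multiset.mem_cons.1 hw with rfl | hw
        · exact hd0
        · exact hr w (by simp [hw])
      · intro l hl hln
        obtain ⟨w, hw, hlw⟩ := hcov l hl hln
        rcases Multiset.mem_cons.1 hw with rfl | hw
        · exact ⟨d, by simp, hcd _ (.inl hlw)⟩
        rcases Multiset.mem_cons.1 hw with rfl | hw
        · exact ⟨d, by simp, hcd _ (.inr hlw)⟩
        · exact ⟨w, by simp [hw], hlw⟩
      · simp only [Multiset.map_cons, Multiset.sum_cons]
        linarith

/-- The circles enclosing the points `i, …, e` of a sequence. -/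
def enclosingRange (x y : ℕ → ℝ) (i e : ℕ) : Set (ℝ × ℝ) :=
  {u | ∀ k, i ≤ k → k ≤ e → axisDist p (x k, y k) u.1 ≤ u.2}

omit [Fact (1 ≤ p)] in
theorem upClosed_enclosingRange (x y : ℕ → ℝ) (i e : ℕ) : UpClosed (enclosingRange p x y i e) :=
  fun _ _ _ h h' k hk hk' => (h k hk hk').trans h'

theorem convex_enclosingRange (x y : ℕ → ℝ) (i e : ℕ) : Convex ℝ (enclosingRange p x y i e) := by
  have : enclosingRange p x y i e
      = ⋂ k, ⋂ (_ : i ≤ k), ⋂ (_ : k ≤ e), enclosing p (x k, y k) := by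
    ext u; simp [enclosingRange, enclosing]
  rw [this]
  exact convex_iInter fun k => convex_iInter fun _ => convex_iInter fun _ =>
    convex_enclosing p (x k, y k)

omit [Fact (1 ≤ p)] in
theorem enclosingRange_self (x y : ℕ → ℝ) (i : ℕ) :
    enclosingRange p x y i i = enclosing p (x i, y i) := by
  ext u
  simp only [enclosingRange, enclosing, Set.mem_ofPred_eq]
  exact ⟨fun h => h i le_rfl le_rfl, fun h k h1 h2 => by rwa [le_antisymm h2 h1]⟩

omit [Fact (1 ≤ p)] in
theorem enclosingRange_succ_right (x y : ℕ → ℝ) {i e : ℕ} (h : i ≤ e + 1) :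
    enclosingRange p x y i (e + 1)
      = enclosing p (x (e + 1), y (e + 1)) ∩ enclosingRange p x y i e := by
  ext u
  simp only [enclosingRange, enclosing, Set.mem_ofPred_eq, Set.mem_inter_iff]
  exact ⟨fun H => ⟨H _ h le_rfl, fun k h1 h2 => H k h1 (by omega)⟩, fun H k h1 h2 => by
    rcases h2.eq_or_lt with rfl | h2
    · exact H.1
    · exact H.2 k h1 (by omega)⟩

omit [Fact (1 ≤ p)] in
theorem enclosingRange_succ_left (x y : ℕ → ℝ) {i e : ℕ} (h : i ≤ e) :
    enclosingRange p x y i e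
      = enclosing p (x i, y i) ∩ enclosingRange p x y (i + 1) e := by
  ext u
  simp only [enclosingRange, enclosing, Set.mem_ofPred_eq, Set.mem_inter_iff]
  exact ⟨fun H => ⟨H _ le_rfl h, fun k h1 h2 => H k (by omega) h2⟩, fun H k h1 h2 => by
    rcases h1.eq_or_lt with rfl | h1
    · exact H.1
    · exact H.2 k h1 h2⟩

/-- Extending both ranges by one point: the update of the least enclosing circle. -/
theorem lexLeast_enclosingRange {x y : ℕ → ℝ} {i e : ℕ} (hie : i ≤ e) {c₁ r₁ c₂ r₂ : ℝ}
    (hv : LexLeast (enclosingRange p x y i e) c₁ r₁)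
    (hu : LexLeast (enclosingRange p x y (i + 1) (e + 1)) c₂ r₂) :
    (axisDist p (x (e + 1), y (e + 1)) c₁ ≤ r₁ →
      LexLeast (enclosingRange p x y i (e + 1)) c₁ r₁) ∧
    (axisDist p (x i, y i) c₂ ≤ r₂ → LexLeast (enclosingRange p x y i (e + 1)) c₂ r₂) ∧
    (¬ axisDist p (x (e + 1), y (e + 1)) c₁ ≤ r₁ → ¬ axisDist p (x i, y i) c₂ ≤ r₂ →
      LexLeast (enclosingRange p x y i (e + 1))
        (pinnedCenter p (x i, y i) (x (e + 1), y (e + 1)))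
        (axisDist p (x i, y i) (pinnedCenter p (x i, y i) (x (e + 1), y (e + 1))))) := by
  have e1 := enclosingRange_succ_right p x y (show i ≤ e + 1 by omega)
  have e2 := enclosingRange_succ_left p x y (show i ≤ e + 1 by omega)
  refine ⟨fun h => ?_, fun h => ?_, fun h h' => ?_⟩
  · rw [e1]
    exact hv.mono Set.inter_subset_right ⟨h, hv.1⟩
  · rw [e2]
    exact hu.mono Set.inter_subset_right ⟨h, hu.1⟩
  · rw [enclosingRange_succ_left p x y hie] at hv
    rw [enclosingRange_succ_right p x y (show i + 1 ≤ e + 1 by omega)] at hu e2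
    rw [e2, ← Set.inter_assoc]
    exact lexLeast_pinnedCenter p (convex_enclosingRange p x y (i + 1) e)
      (upClosed_enclosingRange p x y (i + 1) e) hv hu h h'

end Partition

/-! ### Reasoning about programs -/

section Programs

/-- No loops. -/
def Prog.LoopFree : Prog → Prop
  | .seq P Q => P.LoopFree ∧ Q.LoopFree
  | .cond _ P Q => P.LoopFree ∧ Q.LoopFree
  | .loop _ _ => False
  | _ => True

/-- A bound for the running time of a loop-free program. -/
def Prog.bound : Prog → ℕ
  | .skip => 1
  | .nset _ e => e.cost + 1
  | .rset _ e => e.cost + 1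
  | .nput _ i e => i.cost + e.cost + 1
  | .rput _ i e => i.cost + e.cost + 1
  | .seq P Q => P.bound + Q.bound
  | .cond b P Q => b.cost + max P.bound Q.bound
  -- Junk value: `bound` is used only for loop-free programs.
  | .loop _ _ => 0

variable (p : ℝ≥0∞) [Fact (1 ≤ p)]

open Classical in
/-- The effect of a loop-free program on the memory. -/
noncomputable def Prog.run : Prog → Store → Store
  | .skip, σ => σ
  | .nset x e, σ => σ.nset x (e.eval σ)
  | .rset x e, σ => σ.rset x (e.eval p σ)
  | .nput a i e, σ => σ.nput a (i.eval σ) (e.eval σ)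
  | .rput a i e, σ => σ.rput a (i.eval σ) (e.eval p σ)
  | .seq P Q, σ => Q.run (P.run σ)
  | .cond b P Q, σ => if b.holds p σ then P.run σ else Q.run σ
  | .loop _ _, σ => σ

/-- Started in `σ`, the program halts within `T` steps in a memory satisfying `Q`. -/
def Runs (P : Prog) (σ : Store) (T : ℕ) (Q : Store → Prop) : Prop :=
  ∃ τ t, Exec p P σ τ t ∧ t ≤ T ∧ Q τ

variable {p}

theorem Runs.mono {P : Prog} {σ : Store} {T T' : ℕ} {Q Q' : Store → Prop} (h : Runs p P σ T Q)
    (hT : T ≤ T') (hQ : ∀ τ, Q τ → Q' τ) : Runs p P σ T' Q' := by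
  obtain ⟨τ, t, h1, h2, h3⟩ := h
  exact ⟨τ, t, h1, h2.trans hT, hQ τ h3⟩

theorem Runs.seq {P P' : Prog} {σ : Store} {T T' : ℕ} {Q Q' : Store → Prop}
    (h : Runs p P σ T Q) (h' : ∀ τ, Q τ → Runs p P' τ T' Q') :
    Runs p (.seq P P') σ (T + T') Q' := by
  obtain ⟨τ, t, h1, h2, h3⟩ := h
  obtain ⟨υ, s, k1, k2, k3⟩ := h' τ h3
  exact ⟨υ, t + s, .seq h1 k1, by omega, k3⟩

theorem Prog.LoopFree.exec {P : Prog} (h : P.LoopFree) (σ : Store) :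
    ∃ t, Exec p P σ (P.run p σ) t ∧ t ≤ P.bound := by
  induction P generalizing σ with
  | skip => exact ⟨_, .skip σ, le_rfl⟩
  | nset x e => exact ⟨_, .nset x e σ, le_rfl⟩
  | rset x e => exact ⟨_, .rset x e σ, le_rfl⟩
  | nput a i e => exact ⟨_, .nput a i e σ, le_rfl⟩
  | rput a i e => exact ⟨_, .rput a i e σ, le_rfl⟩
  | seq P Q hP hQ =>
    obtain ⟨s, h1, h2⟩ := hP h.1 σ
    obtain ⟨t, k1, k2⟩ := hQ h.2 (P.run p σ)
    exact ⟨_, .seq h1 k1, Nat.add_le_add h2 k2⟩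
  | cond b P Q hP hQ =>
    by_cases hb : b.holds p σ
    · obtain ⟨s, h1, h2⟩ := hP h.1 σ
      refine ⟨b.cost + s, ?_, ?_⟩
      · rw [Prog.run, if_pos hb]
        exact .condTrue hb h1
      · exact Nat.add_le_add_left (h2.trans (le_max_left _ _)) _
    · obtain ⟨s, h1, h2⟩ := hQ h.2 σ
      refine ⟨b.cost + s, ?_, ?_⟩
      · rw [Prog.run, if_neg hb]
        exact .condFalse hb h1
      · exact Nat.add_le_add_left (h2.trans (le_max_right _ _)) _
  | loop b P hP => exact h.elim

theorem Prog.LoopFree.runs {P : Prog} (h : P.LoopFree) {σ : Store} {Q : Store → Prop}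
    (hQ : Q (P.run p σ)) : Runs p P σ P.bound Q := by
  obtain ⟨t, h1, h2⟩ := h.exec (p := p) σ
  exact ⟨_, t, h1, h2, hQ⟩

/-- A loop with an invariant and a variant. -/
theorem Runs.loop {b : Test} {P : Prog} {T : ℕ} (I : ℕ → Store → Prop)
    (hstep : ∀ m σ, I m σ → b.holds p σ → Runs p P σ T (fun τ => ∃ m' < m, I m' τ))
    (m : ℕ) (σ : Store) (hI : I m σ) :
    Runs p (.loop b P) σ (m * (b.cost + T) + b.cost) (fun τ => ¬ b.holds p τ ∧ ∃ m', I m' τ) := by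
  induction m using Nat.strong_induction_on generalizing σ with
  | _ m ih =>
    by_cases hb : b.holds p σ
    · obtain ⟨τ, s, h1, h2, m', hm', hI'⟩ := hstep m σ hI hb
      obtain ⟨υ, t, k1, k2, k3⟩ := ih m' hm' τ hI'
      refine ⟨υ, b.cost + s + t, .loopStep hb h1 k1, ?_, k3⟩
      have : (m' + 1) * (b.cost + T) ≤ m * (b.cost + T) := Nat.mul_le_mul_right _ hm'
      rw [Nat.succ_mul] at this
      omega
    · exact ⟨σ, b.cost, .loopDone hb, Nat.le_add_left _ _, hb, m, hI⟩

end Programs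

/-! ### Sorting the clients by abscissa

The natural variables `2` and `3` are loop counters. -/

section Sorting

/-- Exchange the clients `i` and `j < i` if they are in the wrong order, and advance `j`. -/
def swapStep : Prog :=
  .seq
    (.cond (.rlt (.get 0 (.var 2)) (.get 0 (.var 3)))
      (.seq (.rset 0 (.get 0 (.var 2)))
      (.seq (.rset 1 (.get 1 (.var 2)))
      (.seq (.rput 0 (.var 2) (.get 0 (.var 3)))
      (.seq (.rput 1 (.var 2) (.get 1 (.var 3)))
      (.seq (.rput 0 (.var 3) (.var 0))
      (.rput 1 (.var 3) (.var 1)))))))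
      .skip)
    (.nset 3 (.add (.var 3) (.lit 1)))

/-- Exchange sort. -/
def sortProg : Prog :=
  .loop (.nlt (.var 2) (.var 0))
    (.seq (.nset 3 (.lit 0))
    (.seq (.loop (.nlt (.var 3) (.var 2)) swapStep)
    (.nset 2 (.add (.var 2) (.lit 1)))))

/-- The first `n` entries of two arrays hold the points of the set `S`. -/
def Holds (n : ℕ) (x y : ℕ → ℝ) (S : Set (ℝ × ℝ)) : Prop :=
  (fun k => (x k, y k)) '' Set.Iio n = S

theorem Holds.swap {n : ℕ} {x y x' y' : ℕ → ℝ} {S : Set (ℝ × ℝ)} (h : Holds n x y S) {i j : ℕ}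
    (hi : i < n) (hj : j < n) (hx : ∀ k, x' k = x (Equiv.swap i j k))
    (hy : ∀ k, y' k = y (Equiv.swap i j k)) : Holds n x' y' S := by
  have hs : ∀ k, k < n → Equiv.swap i j k < n := fun k hk => by
    rw [Equiv.swap_apply_def]; split_ifs <;> assumption
  rw [← h, Holds]
  ext q
  constructor
  · rintro ⟨k, hk, rfl⟩
    exact ⟨_, hs k hk, by simp [hx, hy]⟩
  · rintro ⟨k, hk, rfl⟩
    exact ⟨_, hs k hk, by simp [hx, hy]⟩

variable {p : ℝ≥0∞} [Fact (1 ≤ p)]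

theorem run_swapStep (σ : Store) (hne : σ.nvar 3 ≠ σ.nvar 2) :
    (swapStep.run p σ).nvar 0 = σ.nvar 0 ∧ (swapStep.run p σ).nvar 2 = σ.nvar 2 ∧
    (swapStep.run p σ).nvar 3 = σ.nvar 3 + 1 ∧
    (σ.rarr 0 (σ.nvar 2) < σ.rarr 0 (σ.nvar 3) →
      (∀ k, (swapStep.run p σ).rarr 0 k = σ.rarr 0 (Equiv.swap (σ.nvar 2) (σ.nvar 3) k)) ∧
      (∀ k, (swapStep.run p σ).rarr 1 k = σ.rarr 1 (Equiv.swap (σ.nvar 2) (σ.nvar 3) k))) ∧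
    (¬ σ.rarr 0 (σ.nvar 2) < σ.rarr 0 (σ.nvar 3) →
      (swapStep.run p σ).rarr 0 = σ.rarr 0 ∧ (swapStep.run p σ).rarr 1 = σ.rarr 1) := by
  by_cases h : σ.rarr 0 (σ.nvar 2) < σ.rarr 0 (σ.nvar 3)
  · simp only [swapStep, Prog.run, Test.holds, RExp.eval, NExp.eval, h, if_true]
    simp [Store.nset, Store.rset, Store.rput, Function.update_apply, Equiv.swap_apply_def]
    grind
  · simp only [swapStep, Prog.run, Test.holds, RExp.eval, NExp.eval, h, if_false]
    simp [Store.nset]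

/-- The invariant of the inner loop of the sort. -/
structure SortInv (n : ℕ) (S : Set (ℝ × ℝ)) (i j : ℕ) (σ : Store) : Prop where
  size : σ.nvar 0 = n
  vari : σ.nvar 2 = i
  varj : σ.nvar 3 = j
  lt : i < n
  le : j ≤ i
  holds : Holds n (σ.rarr 0) (σ.rarr 1) S
  sorted : ∀ a b, a ≤ b → b < i → σ.rarr 0 a ≤ σ.rarr 0 b
  below : ∀ a, a < j → σ.rarr 0 a ≤ σ.rarr 0 i

/-- Insertion in disguise: entry `i` carries the value being inserted into the sorted prefix. After
an exchange, it carries the old entry `j`, which is at least everything up to `j` and at most the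
later entries of the prefix. -/
theorem SortInv.step {n : ℕ} {S : Set (ℝ × ℝ)} {i j : ℕ} {σ : Store} (h : SortInv n S i j σ)
    (hji : j < i) : SortInv n S i (j + 1) (swapStep.run p σ) := by
  obtain ⟨h0, h2, h3, hlt, hge⟩ := run_swapStep (p := p) σ (by rw [h.vari, h.varj]; omega)
  rw [h.size] at h0
  rw [h.vari] at h2
  rw [h.varj] at h3
  rw [h.vari, h.varj] at hlt hge
  by_cases hc : σ.rarr 0 i < σ.rarr 0 j
  · obtain ⟨hx, hy⟩ := hlt hc
    refine ⟨h0, h2, h3, h.lt, hji, h.holds.swap h.lt (hji.trans h.lt) hx hy, ?_, ?_⟩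
    · intro a b hab hb
      have := h.sorted a b hab hb
      have := h.sorted j b
      have := h.below a
      rw [hx, hx, Equiv.swap_apply_def, Equiv.swap_apply_def]
      grind
    · intro a ha
      have := h.sorted a j
      rw [hx, hx, Equiv.swap_apply_def, Equiv.swap_apply_def]
      grind
  · obtain ⟨hx, hy⟩ := hge hc
    refine ⟨h0, h2, h3, h.lt, hji, by rw [hx, hy]; exact h.holds, by rw [hx]; exact h.sorted, ?_⟩
    intro a ha
    rw [hx]
    have := h.below a
    grind

/-- The running time of the sort. -/
def sortTime (n : ℕ) : ℕ := n * (3 + (2 + (n * (3 + swapStep.bound) + 3 + 4))) + 3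

theorem runs_sortProg {n : ℕ} {S : Set (ℝ × ℝ)} {σ : Store} (h0 : σ.nvar 0 = n)
    (h2 : σ.nvar 2 = 0) (hS : Holds n (σ.rarr 0) (σ.rarr 1) S) :
    Runs p sortProg σ (sortTime n) (fun τ => τ.nvar 0 = n ∧ τ.nvar 2 = n ∧
      Holds n (τ.rarr 0) (τ.rarr 1) S ∧
      ∀ a b, a ≤ b → b < n → τ.rarr 0 a ≤ τ.rarr 0 b) := by
  refine (Runs.loop (fun m τ => ∃ i, i + m = n ∧ τ.nvar 0 = n ∧ τ.nvar 2 = i ∧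
    Holds n (τ.rarr 0) (τ.rarr 1) S ∧ ∀ a b, a ≤ b → b < i → τ.rarr 0 a ≤ τ.rarr 0 b)
    (T := 2 + (n * (3 + swapStep.bound) + 3 + 4)) ?_ n σ
    ⟨0, by omega, h0, h2, hS, by omega⟩).mono le_rfl ?_
  · rintro m τ ⟨i, him, h0, h2, hS, hsort⟩ hb
    simp only [Test.holds, NExp.eval, h0, h2] at hb
    refine Runs.seq (Q := SortInv n S i 0) (Prog.LoopFree.runs (by trivial) ?_) ?_
    · exact ⟨by simpa [Prog.run, Store.nset] using h0, by simpa [Prog.run, Store.nset] using h2,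
        by simp [Prog.run, Store.nset, NExp.eval], hb, by omega, hS, hsort, by omega⟩
    intro τ hτ
    refine Runs.seq (Q := SortInv n S i i) ?_ ?_
    · refine (Runs.loop (fun m τ => ∃ j, j + m = i ∧ SortInv n S i j τ) (T := swapStep.bound)
        ?_ i τ ⟨0, by omega, hτ⟩).mono ?_ ?_
      · rintro m τ ⟨j, hjm, hτ⟩ hb
        simp only [Test.holds, NExp.eval, hτ.vari, hτ.varj] at hb
        exact Prog.LoopFree.runs (by simp [swapStep, Prog.LoopFree])
          ⟨m - 1, by omega, j + 1, by omega, hτ.step hb⟩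
      · exact Nat.add_le_add_right (Nat.mul_le_mul_right _ hb.le) _
      · rintro τ ⟨hb, m, j, hjm, hτ⟩
        simp only [Test.holds, NExp.eval, hτ.vari, hτ.varj] at hb
        obtain rfl : j = i := by have := hτ.le; omega
        exact hτ
    · intro τ hτ
      refine Prog.LoopFree.runs (by trivial) ⟨m - 1, by omega, i + 1, by omega, ?_, ?_, hτ.holds, ?_⟩
      · simpa [Prog.run, Store.nset] using hτ.size
      · simp [Prog.run, Store.nset, NExp.eval, hτ.vari]
      · intro a b hab hb
        change τ.rarr 0 a ≤ τ.rarr 0 b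
        have := hτ.sorted a b hab
        have := hτ.below a
        grind
  · rintro τ ⟨hb, m, i, him, h0, h2, hS, hsort⟩
    simp only [Test.holds, NExp.eval, h0, h2] at hb
    obtain rfl : i = n := by omega
    exact ⟨h0, h2, hS, hsort⟩

end Sorting

/-! ### Dynamic program over the sorted clients

The real variables `0`, `1` hold the center and the radius of the current circle, the real arrays
`4`, `5` the centers and radii of the least circles enclosing a range that starts at the current
client. The real array `6` holds the optimal costs of suffixes, the real arrays `7`, `8` the first
circle of an optimal cover of a suffix, and the natural array `0` the first client outside it. -/

section Rows

/-- Record the current circle, of cost `e`, as first circle for the suffix at `i`. -/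
def record (e : RExp) (f : NExp) : Prog :=
  .seq (.rput 6 (.var 2) e)
  (.seq (.nput 0 (.var 2) f)
  (.seq (.rput 7 (.var 2) (.var 0))
  (.rput 8 (.var 2) (.var 1))))

/-- The circle pinned by the clients `i` and `f`. -/
def pinCircle (f : NExp) : Prog :=
  .seq (.rset 0 (.pinned (.get 0 (.var 2)) (.get 1 (.var 2)) (.get 0 f) (.get 1 f)))
  (.rset 1 (.len (.sub (.get 0 (.var 2)) (.var 0)) (.get 1 (.var 2))))

/-- Decrease `i` and treat the range `{i}`. -/
def startRow : Prog :=
  .seq (.nset 2 (.sub (.var 2) (.lit 1)))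
  (.seq (.nset 3 (.add (.var 2) (.lit 1)))
  (.seq (pinCircle (.var 2))
  (.seq (.rput 4 (.var 2) (.var 0))
  (.seq (.rput 5 (.var 2) (.var 1))
  (record (.add (.var 1) (.get 6 (.var 3))) (.var 3))))))

/-- Update the current circle to the range `i, …, j`. -/
def growCircle : Prog :=
  .cond (.rlt (.var 1) (.len (.sub (.get 0 (.var 3)) (.var 0)) (.get 1 (.var 3))))
    (.cond (.rlt (.get 5 (.var 3))
        (.len (.sub (.get 0 (.var 2)) (.get 4 (.var 3))) (.get 1 (.var 2))))
      (pinCircle (.var 3))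
      (.seq (.rset 0 (.get 4 (.var 3))) (.rset 1 (.get 5 (.var 3)))))
    .skip

/-- Treat the range `i, …, j` and advance `j`. -/
def rowStep : Prog :=
  .seq growCircle
  (.seq (.rput 4 (.var 3) (.var 0))
  (.seq (.rput 5 (.var 3) (.var 1))
  (.seq (.nset 3 (.add (.var 3) (.lit 1)))
  (.cond (.rlt (.add (.var 1) (.get 6 (.var 3))) (.get 6 (.var 2)))
    (record (.add (.var 1) (.get 6 (.var 3))) (.var 3))
    .skip))))

def rowsProg : Prog :=
  .seq (.rput 6 (.var 2) (.lit 0))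
  (.loop (.nlt (.lit 0) (.var 2))
    (.seq startRow (.loop (.nlt (.var 3) (.var 0)) rowStep)))

variable (p : ℝ≥0∞) [Fact (1 ≤ p)]

/-- The entries of the tables for the suffix at `k` describe a first circle that is optimal among
those that enclose a range ending before `m`. -/
structure Entry (n : ℕ) (x y D rc rr : ℕ → ℝ) (nxt : ℕ → ℕ) (k m : ℕ) : Prop where
  lt : k < nxt k
  le : nxt k ≤ n
  mem : ∀ l, k ≤ l → l < nxt k → axisDist p (x l, y l) (rc k) ≤ rr k
  cost : D k = rr k + D (nxt k)
  min : ∀ e c r, k ≤ e → e < m → (∀ l, k ≤ l → l ≤ e → axisDist p (x l, y l) c ≤ r) →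
    D k ≤ r + D (e + 1)

variable {p}

omit [Fact (1 ≤ p)] in
-- An entry at `k` depends on costs from `k` onwards only, so it survives the table writes at
-- smaller indices.
theorem Entry.congr {n : ℕ} {x y D rc rr D' rc' rr' : ℕ → ℝ} {nxt nxt' : ℕ → ℕ} {k m : ℕ}
    (h : Entry p n x y D rc rr nxt k m) (hD : ∀ l, k ≤ l → D' l = D l) (hc : rc' k = rc k)
    (hr : rr' k = rr k) (hn : nxt' k = nxt k) : Entry p n x y D' rc' rr' nxt' k m := by
  obtain ⟨h1, h2, h3, h4, h5⟩ := h
  refine ⟨by rwa [hn], by rwa [hn], by rwa [hn, hc, hr], ?_, ?_⟩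
  · rw [hD k le_rfl, hr, hn, hD _ h1.le, h4]
  · intro e c r hke hem hl
    rw [hD k le_rfl, hD (e + 1) (by omega)]
    exact h5 e c r hke hem hl

/-- The memory between two rows. -/
structure RowInv (p : ℝ≥0∞) [Fact (1 ≤ p)] (n : ℕ) (x y : ℕ → ℝ) (i : ℕ) (σ : Store) :
    Prop where
  size : σ.nvar 0 = n
  hx : σ.rarr 0 = x
  hy : σ.rarr 1 = y
  vari : σ.nvar 2 = i
  le : i ≤ n
  last : σ.rarr 6 n = 0
  row : ∀ e, i ≤ e → e < n → LexLeast (enclosingRange p x y i e) (σ.rarr 4 e) (σ.rarr 5 e)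
  entry : ∀ k, i ≤ k → k < n →
    Entry p n x y (σ.rarr 6) (σ.rarr 7) (σ.rarr 8) (σ.narr 0) k n

/-- The memory within the row of `i`, the range `i, …, e` having been treated. -/
structure ColInv (p : ℝ≥0∞) [Fact (1 ≤ p)] (n : ℕ) (x y : ℕ → ℝ) (i e : ℕ) (σ : Store) :
    Prop where
  size : σ.nvar 0 = n
  hx : σ.rarr 0 = x
  hy : σ.rarr 1 = y
  vari : σ.nvar 2 = i
  varj : σ.nvar 3 = e + 1
  le : i ≤ e
  lt : e < n
  last : σ.rarr 6 n = 0
  cur : LexLeast (enclosingRange p x y i e) (σ.rvar 0) (σ.rvar 1)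
  row : ∀ e', i ≤ e' → e' ≤ e →
    LexLeast (enclosingRange p x y i e') (σ.rarr 4 e') (σ.rarr 5 e')
  oldRow : ∀ e', e < e' → e' < n →
    LexLeast (enclosingRange p x y (i + 1) e') (σ.rarr 4 e') (σ.rarr 5 e')
  entry : ∀ k, i < k → k < n →
    Entry p n x y (σ.rarr 6) (σ.rarr 7) (σ.rarr 8) (σ.narr 0) k n
  newEntry : Entry p n x y (σ.rarr 6) (σ.rarr 7) (σ.rarr 8) (σ.narr 0) i (e + 1)

theorem RowInv.start {n : ℕ} {x y : ℕ → ℝ} {i : ℕ} {σ : Store} (h : RowInv p n x y (i + 1) σ) :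
    ColInv p n x y i i (startRow.run p σ) := by
  obtain ⟨h0, hx, hy, h2, hle, hlast, hrow, hent⟩ := h
  set C := pinnedCenter p (x i, y i) (x i, y i) with hC
  have hcur : LexLeast (enclosingRange p x y i i) C (axisDist p (x i, y i) C) := by
    rw [enclosingRange_self]; exact lexLeast_pinnedCenter_self p _
  have e0 : (startRow.run p σ).rvar 0 = C := by
    simp [startRow, pinCircle, record, Prog.run, RExp.eval, NExp.eval, Store.nset, Store.rset,
      Store.rput, Store.nput, h2, hx, hy, hC]
  have e1 : (startRow.run p σ).rvar 1 = axisDist p (x i, y i) C := by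
    simp [startRow, pinCircle, record, Prog.run, RExp.eval, NExp.eval, Store.nset, Store.rset,
      Store.rput, Store.nput, h2, hx, hy, hC, axisDist]
  have e4 : (startRow.run p σ).rarr 4 = Function.update (σ.rarr 4) i C := by
    simp [startRow, pinCircle, record, Prog.run, RExp.eval, NExp.eval, Store.nset, Store.rset,
      Store.rput, Store.nput, h2, hx, hy, hC]
  have e5 : (startRow.run p σ).rarr 5
      = Function.update (σ.rarr 5) i (axisDist p (x i, y i) C) := by
    simp [startRow, pinCircle, record, Prog.run, RExp.eval, NExp.eval, Store.nset, Store.rset,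
      Store.rput, Store.nput, h2, hx, hy, hC, axisDist]
  have e6 : (startRow.run p σ).rarr 6
      = Function.update (σ.rarr 6) i (axisDist p (x i, y i) C + σ.rarr 6 (i + 1)) := by
    simp [startRow, pinCircle, record, Prog.run, RExp.eval, NExp.eval, Store.nset, Store.rset,
      Store.rput, Store.nput, h2, hx, hy, hC, axisDist]
  have e7 : (startRow.run p σ).rarr 7 = Function.update (σ.rarr 7) i C := by
    simp [startRow, pinCircle, record, Prog.run, RExp.eval, NExp.eval, Store.nset, Store.rset,
      Store.rput, Store.nput, h2, hx, hy, hC]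
  have e8 : (startRow.run p σ).rarr 8
      = Function.update (σ.rarr 8) i (axisDist p (x i, y i) C) := by
    simp [startRow, pinCircle, record, Prog.run, RExp.eval, NExp.eval, Store.nset, Store.rset,
      Store.rput, Store.nput, h2, hx, hy, hC, axisDist]
  have eN : (startRow.run p σ).narr 0 = Function.update (σ.narr 0) i (i + 1) := by
    simp [startRow, pinCircle, record, Prog.run, NExp.eval, Store.nset, Store.rset,
      Store.rput, Store.nput, h2]
  refine ⟨?_, ?_, ?_, ?_, ?_, le_rfl, hle, ?_, ?_, ?_, ?_, ?_, ?_⟩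
  · simpa [startRow, pinCircle, record, Prog.run, Store.nset, Store.rset, Store.rput, Store.nput]
  · simpa [startRow, pinCircle, record, Prog.run, Store.nset, Store.rset, Store.rput, Store.nput]
  · simpa [startRow, pinCircle, record, Prog.run, Store.nset, Store.rset, Store.rput, Store.nput]
  · simp [startRow, pinCircle, record, Prog.run, Store.nset, Store.rset, Store.rput, Store.nput,
      NExp.eval, h2]
  · simp [startRow, pinCircle, record, Prog.run, Store.nset, Store.rset, Store.rput, Store.nput,
      NExp.eval, h2]
  · rw [e6, Function.update_of_ne (by omega), hlast]
  · rw [e0, e1]; exact hcur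
  · intro e' h1 h2
    obtain rfl := le_antisymm h2 h1
    rw [e4, e5, Function.update_self, Function.update_self]
    exact hcur
  · intro e' h1 h2
    rw [e4, e5, Function.update_of_ne h1.ne', Function.update_of_ne h1.ne']
    exact hrow e' h1 h2
  · intro k h1 h2
    rw [e6, e7, e8, eN]
    exact (hent k h1 h2).congr (fun l hl => Function.update_of_ne (by omega) _ _)
      (Function.update_of_ne (by omega) _ _) (Function.update_of_ne (by omega) _ _)
      (Function.update_of_ne (by omega) _ _)
  · rw [e6, e7, e8, eN]
    refine ⟨by simp, by simpa using hle, ?_, by simp, ?_⟩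
    · intro l h1 h2
      rw [Function.update_self] at h2
      obtain rfl : l = i := by omega
      simp
    · intro e c r h1 h2 hl
      obtain rfl : e = i := by omega
      simp only [Function.update_self, Function.update_of_ne (show e + 1 ≠ e by omega),
        add_le_add_iff_right]
      have := hcur.2 c r (by simpa [enclosingRange] using hl)
      grind

theorem ColInv.finish {n : ℕ} {x y : ℕ → ℝ} {i e : ℕ} {σ : Store} (h : ColInv p n x y i e σ)
    (he : e + 1 = n) : RowInv p n x y i σ := by
  refine ⟨h.size, h.hx, h.hy, h.vari, h.le.trans h.lt.le, h.last,
    fun e' h1 h2 => h.row e' h1 (by omega), fun k h1 h2 => ?_⟩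
  rcases h1.eq_or_lt with rfl | h1
  · exact he ▸ h.newEntry
  · exact h.entry k h1 h2

/-- The cases of `lexLeast_enclosingRange`: arrays `4` and `5` at `e + 1` have not been overwritten
yet and still describe the range from `i + 1`, so one pair of arrays serves both rows. -/
theorem ColInv.run_growCircle {n : ℕ} {x y : ℕ → ℝ} {i e : ℕ} {σ : Store}
    (h : ColInv p n x y i e σ) (he : e + 1 < n) : ∃ C R, growCircle.run p σ = (σ.rset 0 C).rset 1 R ∧
      LexLeast (enclosingRange p x y i (e + 1)) C R := by
  obtain ⟨H1, H2, H3⟩ := lexLeast_enclosingRange p h.le h.cur (h.oldRow (e + 1) (by omega) he)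
  by_cases h1 : σ.rvar 1 < axisDist p (x (e + 1), y (e + 1)) (σ.rvar 0)
  · have h1' := h1
    unfold axisDist at h1'
    by_cases h2 : σ.rarr 5 (e + 1) < axisDist p (x i, y i) (σ.rarr 4 (e + 1))
    · refine ⟨_, _, ?_, H3 (not_le.2 h1) (not_le.2 h2)⟩
      unfold axisDist at h2
      simp [growCircle, pinCircle, Prog.run, Test.holds, RExp.eval, NExp.eval, h.vari, h.varj,
        h.hx, h.hy, h1', h2, axisDist, Store.rset]
    · refine ⟨_, _, ?_, H2 (not_lt.1 h2)⟩
      unfold axisDist at h2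
      simp [growCircle, pinCircle, Prog.run, Test.holds, RExp.eval, NExp.eval, h.vari, h.varj,
        h.hx, h.hy, h1', h2, Store.rset]
  · refine ⟨_, _, ?_, H1 (not_lt.1 h1)⟩
    unfold axisDist at h1
    simp [growCircle, pinCircle, Prog.run, Test.holds, RExp.eval, NExp.eval, h.varj,
        h.hx, h.hy, h1, Store.rset]

theorem ColInv.step {n : ℕ} {x y : ℕ → ℝ} {i e : ℕ} {σ : Store} (h : ColInv p n x y i e σ)
    (he : e + 1 < n) : ColInv p n x y i (e + 1) (rowStep.run p σ) := by
  obtain ⟨C, R, hrun, hcur⟩ := h.run_growCircle he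
  obtain ⟨h0, hx, hy, h2, h3, hle, hlt, hlast, -, hrow, hold, hent, hnew⟩ := h
  have hie : i ≠ e + 1 := by omega
  -- Among all circles for this range only the least radius can improve the cost, since the
  -- remaining suffix is the same.
  have hmin : ∀ c r, (∀ l, i ≤ l → l ≤ e + 1 → axisDist p (x l, y l) c ≤ r) → R ≤ r := by
    intro c r hl
    have := hcur.2 c r hl
    grind
  have hrow' : ∀ e', i ≤ e' → e' ≤ e + 1 → LexLeast (enclosingRange p x y i e')
      (Function.update (σ.rarr 4) (e + 1) C e') (Function.update (σ.rarr 5) (e + 1) R e') := by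
    intro e' h1 h2
    rcases h2.eq_or_lt with rfl | h2
    · simpa using hcur
    · rw [Function.update_of_ne (by omega), Function.update_of_ne (by omega)]
      exact hrow e' h1 (by omega)
  have hold' : ∀ e', e + 1 < e' → e' < n → LexLeast (enclosingRange p x y (i + 1) e')
      (Function.update (σ.rarr 4) (e + 1) C e') (Function.update (σ.rarr 5) (e + 1) R e') := by
    intro e' h1 h2
    rw [Function.update_of_ne (by omega), Function.update_of_ne (by omega)]
    exact hold e' (by omega) h2
  by_cases hc : R + σ.rarr 6 (e + 1 + 1) < σ.rarr 6 i
  · have hr : rowStep.run p σ = ⟨Function.update σ.nvar 3 (e + 1 + 1),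
        Function.update (Function.update σ.rvar 0 C) 1 R,
        Function.update σ.narr 0 (Function.update (σ.narr 0) i (e + 1 + 1)),
        Function.update (Function.update (Function.update (Function.update (Function.update σ.rarr
          4 (Function.update (σ.rarr 4) (e + 1) C)) 5 (Function.update (σ.rarr 5) (e + 1) R))
          6 (Function.update (σ.rarr 6) i (R + σ.rarr 6 (e + 1 + 1))))
          7 (Function.update (σ.rarr 7) i C)) 8 (Function.update (σ.rarr 8) i R)⟩ := by
      rw [rowStep, Prog.run, hrun]
      simp [record, Prog.run, Test.holds, RExp.eval, NExp.eval, Store.nset, Store.rset,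
        Store.rput, Store.nput, h2, h3, hc]
    rw [hr]
    refine ⟨by simpa, by simpa, by simpa, by simpa, by simp, by omega, he, ?_, by simpa,
      by simpa using hrow', by simpa using hold', ?_, ?_⟩
    · simpa [Function.update_of_ne (show n ≠ i by omega)]
    · intro k h1 h2
      refine (hent k h1 h2).congr (fun l hl => ?_) ?_ ?_ ?_
      · simp [Function.update_of_ne (show l ≠ i by omega)]
      all_goals simp [Function.update_of_ne (show k ≠ i by omega)]
    · constructor
      · simp; omega
      · simpa
      · intro l h1 h2
        simp at h2 ⊢
        exact hcur.1 l h1 (by omega)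
      · simp [Function.update_of_ne (show e + 1 + 1 ≠ i by omega)]
      · intro e' c r h1 h2 hl
        simp [Function.update_of_ne (show e' + 1 ≠ i by omega)]
        rcases (show e' ≤ e + 1 by omega).eq_or_lt with rfl | h3
        · linarith [hmin c r hl]
        · exact hc.le.trans (hnew.min e' c r h1 h3 hl)
  · have hr : rowStep.run p σ = ⟨Function.update σ.nvar 3 (e + 1 + 1),
        Function.update (Function.update σ.rvar 0 C) 1 R, σ.narr,
        Function.update (Function.update σ.rarr
          4 (Function.update (σ.rarr 4) (e + 1) C)) 5 (Function.update (σ.rarr 5) (e + 1) R)⟩ := by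
      rw [rowStep, Prog.run, hrun]
      simp [Prog.run, Test.holds, RExp.eval, NExp.eval, Store.nset, Store.rset,
        Store.rput, h2, h3, hc]
    rw [hr]
    refine ⟨by simpa, by simpa, by simpa, by simpa, by simp, by omega, he, by simpa, by simpa,
      by simpa using hrow', by simpa using hold', by simpa using hent, ?_⟩
    obtain ⟨n1, n2, n3, n4, n5⟩ := hnew
    refine ⟨n1, n2, by simpa using n3, by simpa using n4, ?_⟩
    intro e' c r h1 h2 hl
    rcases (show e' ≤ e + 1 by omega).eq_or_lt with rfl | h3
    · have := hmin c r hl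
      simp
      linarith
    · simpa using n5 e' c r h1 h3 hl

/-- The running time of the dynamic program. -/
def rowsTime (n : ℕ) : ℕ :=
  3 + (n * (3 + (startRow.bound + (n * (3 + rowStep.bound) + 3))) + 3)

theorem runs_rowsProg {n : ℕ} {x y : ℕ → ℝ} {σ : Store} (h0 : σ.nvar 0 = n) (h2 : σ.nvar 2 = n)
    (hx : σ.rarr 0 = x) (hy : σ.rarr 1 = y) :
    Runs p rowsProg σ (rowsTime n) (RowInv p n x y 0) := by
  -- The sort leaves variable `2` at `n`, so the first write sets the cost of the empty suffix.
  refine Runs.seq (Q := RowInv p n x y n) (T := 3) (Prog.LoopFree.runs (by trivial) ?_) ?_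
  · refine ⟨h0, by simpa [Prog.run, Store.rput], by simpa [Prog.run, Store.rput], h2, le_rfl,
      by simp [Prog.run, Store.rput, NExp.eval, RExp.eval, h2], by omega, by omega⟩
  intro τ hτ
  refine (Runs.loop (RowInv p n x y) (T := startRow.bound + (n * (3 + rowStep.bound) + 3))
    ?_ n τ hτ).mono le_rfl ?_
  · intro m τ hτ hb
    simp only [Test.holds, NExp.eval, hτ.vari] at hb
    obtain ⟨i, rfl⟩ : ∃ i, m = i + 1 := ⟨m - 1, by omega⟩
    refine Runs.seq (Prog.LoopFree.runs (by simp [startRow, pinCircle, record, Prog.LoopFree])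
      hτ.start) ?_
    intro τ hτ
    refine (Runs.loop (fun m τ => ∃ e, e + 1 + m = n ∧ ColInv p n x y i e τ) (T := rowStep.bound)
      ?_ (n - (i + 1)) τ ⟨i, by have := hτ.lt; omega, hτ⟩).mono ?_ ?_
    · rintro m τ ⟨e, hem, hτ⟩ hb
      simp only [Test.holds, NExp.eval, hτ.size, hτ.varj] at hb
      exact Prog.LoopFree.runs
        (by simp [rowStep, growCircle, pinCircle, record, Prog.LoopFree])
        ⟨m - 1, by omega, e + 1, by omega, hτ.step hb⟩
    · exact Nat.add_le_add_right (Nat.mul_le_mul_right _ (Nat.sub_le _ _)) _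
    · rintro τ ⟨hb, m, e, hem, hτ⟩
      simp only [Test.holds, NExp.eval, hτ.size, hτ.varj] at hb
      exact ⟨i, by omega, hτ.finish (by omega)⟩
  · rintro τ ⟨hb, m, hτ⟩
    simp only [Test.holds, NExp.eval, hτ.vari] at hb
    obtain rfl : m = 0 := by omega
    exact hτ

end Rows

/-! ### Output -/

section Output

/-- Append the first circle for the suffix at `i` to the output, and pass to the next suffix. -/
def emitStep : Prog :=
  .seq (.rput 2 (.var 1) (.get 7 (.var 2)))
  (.seq (.rput 3 (.var 1) (.get 8 (.var 2)))
  (.seq (.nset 1 (.add (.var 1) (.lit 1)))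
  (.nset 2 (.get 0 (.var 2)))))

def emitProg : Prog :=
  .seq (.nset 1 (.lit 0)) (.loop (.nlt (.var 2) (.var 0)) emitStep)

/-- The whole algorithm. -/
def coverProg : Prog := .seq sortProg (.seq rowsProg emitProg)

variable {p : ℝ≥0∞} [Fact (1 ≤ p)]

/-- The output in `τ` encloses the clients before `i`; with the cost of the suffix at `i` it
amounts to the cost of the suffix at `0`. -/
structure EmitInv (p : ℝ≥0∞) [Fact (1 ≤ p)] (n : ℕ) (x y D rc rr : ℕ → ℝ) (nxt : ℕ → ℕ) (i : ℕ)
    (τ : Store) : Prop where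
  size : τ.nvar 0 = n
  vari : τ.nvar 2 = i
  le : i ≤ n
  hD : τ.rarr 6 = D
  hrc : τ.rarr 7 = rc
  hrr : τ.rarr 8 = rr
  hnxt : τ.narr 0 = nxt
  sum : ∑ j ∈ Finset.range (τ.nvar 1), τ.rarr 3 j + D i = D 0
  nonneg : ∀ j, j < τ.nvar 1 → 0 ≤ τ.rarr 3 j
  mem : ∀ l, l < i → ∃ j, j < τ.nvar 1 ∧ axisDist p (x l, y l) (τ.rarr 2 j) ≤ τ.rarr 3 j

theorem EmitInv.step {n : ℕ} {x y D rc rr : ℕ → ℝ} {nxt : ℕ → ℕ} {i : ℕ} {τ : Store}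
    (h : EmitInv p n x y D rc rr nxt i τ) (hE : Entry p n x y D rc rr nxt i n) :
    EmitInv p n x y D rc rr nxt (nxt i) (emitStep.run p τ) := by
  obtain ⟨h0, h2, hle, hD, hrc, hrr, hnxt, hsum, hnn, hmem⟩ := h
  have hr : emitStep.run p τ = ⟨Function.update (Function.update τ.nvar 1 (τ.nvar 1 + 1)) 2 (nxt i),
      τ.rvar, τ.narr, Function.update (Function.update τ.rarr
        2 (Function.update (τ.rarr 2) (τ.nvar 1) (rc i)))
        3 (Function.update (τ.rarr 3) (τ.nvar 1) (rr i))⟩ := by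
    simp [emitStep, Prog.run, RExp.eval, NExp.eval, Store.nset, Store.rput, h2, hrc, hrr, hnxt]
  rw [hr]
  refine ⟨by simpa, by simp, hE.le, by simpa, by simpa, by simpa, by simpa, ?_, ?_, ?_⟩
  · have : ∑ j ∈ Finset.range (τ.nvar 1), Function.update (τ.rarr 3) (τ.nvar 1) (rr i) j
        = ∑ j ∈ Finset.range (τ.nvar 1), τ.rarr 3 j :=
      Finset.sum_congr rfl fun j hj => Function.update_of_ne (Finset.mem_range.1 hj).ne _ _
    simp [Finset.sum_range_succ, this]
    linarith [hE.cost]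
  · intro j hj
    simp at hj ⊢
    rcases hj.eq_or_lt with rfl | hj
    -- The radius is nonnegative because the circle encloses client `i`.
    · simpa using (axisDist_nonneg p _ _).trans (hE.mem i le_rfl hE.lt)
    · rw [Function.update_of_ne hj.ne]
      exact hnn j hj
  · intro l hl
    rcases lt_or_ge l i with hli | hli
    · obtain ⟨j, hj, hm⟩ := hmem l hli
      exact ⟨j, by simp; omega, by simpa [Function.update_of_ne hj.ne]⟩
    · exact ⟨τ.nvar 1, by simp, by simpa using hE.mem l hli hl⟩

/-- The running time of the output phase. -/
def emitTime (n : ℕ) : ℕ := 2 + (n * (3 + emitStep.bound) + 3)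

theorem runs_emitProg {n : ℕ} {x y : ℕ → ℝ} {σ : Store} (h : RowInv p n x y 0 σ) :
    Runs p emitProg σ (emitTime n)
      (EmitInv p n x y (σ.rarr 6) (σ.rarr 7) (σ.rarr 8) (σ.narr 0) n) := by
  refine Runs.seq (Q := EmitInv p n x y (σ.rarr 6) (σ.rarr 7) (σ.rarr 8) (σ.narr 0) 0) (T := 2)
    (Prog.LoopFree.runs (by trivial) ?_) ?_
  · exact ⟨h.size, h.vari, h.le, rfl, rfl, rfl, rfl, by simp [Prog.run, Store.nset, NExp.eval],
      by simp [Prog.run, Store.nset, NExp.eval], by omega⟩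
  intro τ hτ
  refine (Runs.loop (fun m τ => ∃ i, i + m = n ∧
    EmitInv p n x y (σ.rarr 6) (σ.rarr 7) (σ.rarr 8) (σ.narr 0) i τ) (T := emitStep.bound)
    ?_ n τ ⟨0, by omega, hτ⟩).mono le_rfl ?_
  · rintro m τ ⟨i, him, hτ⟩ hb
    simp only [Test.holds, NExp.eval, hτ.size, hτ.vari] at hb
    have hE := h.entry i (by omega) hb
    have h1 := hE.lt
    have h2 := hE.le
    exact Prog.LoopFree.runs (by simp [emitStep, Prog.LoopFree])
      -- The pointer moves strictly forward, so the number of clients left is a variant.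
      ⟨n - σ.narr 0 i, by omega, σ.narr 0 i, by omega, hτ.step hE⟩
  · rintro τ ⟨hb, m, i, him, hτ⟩
    simp only [Test.holds, NExp.eval, hτ.size, hτ.vari] at hb
    obtain rfl : i = n := by omega
    exact hτ

theorem runs_coverProg {n : ℕ} (Y : Fin n → ℝ × ℝ) :
    Runs p coverProg (inputStore Y) (sortTime n + (rowsTime n + emitTime n))
      (fun σ => IsOptimalCover p Y σ.outCenter σ.outRadius) := by
  have hY : Holds n ((inputStore Y).rarr 0) ((inputStore Y).rarr 1) (Set.range Y) := by
    ext q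
    constructor
    · rintro ⟨k, hk, rfl⟩
      exact ⟨⟨k, hk⟩, by simp [inputStore, Set.mem_Iio.1 hk]⟩
    · rintro ⟨k, rfl⟩
      exact ⟨k, k.2, by simp [inputStore]⟩
  refine Runs.seq (runs_sortProg rfl rfl hY) ?_
  rintro τ ⟨h0, h2, hS, hsort⟩
  refine Runs.seq (runs_rowsProg h0 h2 rfl rfl) ?_
  intro υ hυ
  refine (runs_emitProg hυ).mono le_rfl ?_
  intro σ hσ
  set x := τ.rarr 0
  set y := τ.rarr 1
  have hcl : ∀ k, k < n → ∃ i, Y i = (x k, y k) := fun k hk => by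
    have : (x k, y k) ∈ Set.range Y := hS ▸ ⟨k, hk, rfl⟩
    exact this
  have hcl' : ∀ i, ∃ k, k < n ∧ (x k, y k) = Y i := fun i => by
    have : Y i ∈ Set.range Y := ⟨i, rfl⟩
    rw [← hS] at this
    exact this
  have hsum : ∑ j, σ.outRadius j = υ.rarr 6 0 := by
    have h := hσ.sum
    rw [hυ.last, add_zero] at h
    rw [← h, ← Fin.sum_univ_eq_sum_range (fun j => σ.rarr 3 j)]
    rfl
  refine ⟨⟨fun j => hσ.nonneg j j.2, fun i => ?_⟩, fun m c r hcr => ?_⟩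
  · obtain ⟨k, hk, hki⟩ := hcl' i
    obtain ⟨j, hj, hm⟩ := hσ.mem k hk
    exact ⟨⟨j, hj⟩, (mem_closedBall_axis p).2 (hki ▸ hm)⟩
  · rw [hsum]
    -- The table of suffix costs solves the inequalities required there, so its value at `0` bounds
    -- every competing cover from below.
    have := le_sum_radii p hsort hυ.last
      (fun i e c r h1 h2 hl => (hυ.entry i (Nat.zero_le _) (by omega)).min e c r h1 h2 hl) m
      (Finset.univ.val.map fun j : Fin m => (c j, r j)) (by simp)
      (by simpa using hcr.1) 0 (Nat.zero_le _) ?_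
    · simpa [Multiset.map_map, List.sum_ofFn] using this
    · intro k _ hk
      obtain ⟨i, hi⟩ := hcl k hk
      obtain ⟨j, hj⟩ := hcr.2 i
      rw [mem_closedBall_axis, hi] at hj
      exact ⟨(c j, r j), Multiset.mem_map_of_mem _ (Finset.mem_univ_val j), hj⟩

/-! ### Running time -/

/-- The running time is quadratic. -/
theorem time_le : ∃ K : ℕ, ∀ n, sortTime n + (rowsTime n + emitTime n) ≤ K * (n ^ 2 + 1) := by
  -- After `n ≤ n ^ 2`, the numerical constants amount to `27 * n ^ 2 + 14`.
  refine ⟨30 + swapStep.bound + startRow.bound + rowStep.bound + emitStep.bound,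
    fun n => ?_⟩
  unfold sortTime rowsTime emitTime
  generalize swapStep.bound = s, startRow.bound = a, rowStep.bound = r, emitStep.bound = e
  have hn : n ≤ n ^ 2 := by nlinarith [Nat.le_mul_self n]
  have ha := Nat.mul_le_mul_right a hn
  have he := Nat.mul_le_mul_right e hn
  ring_nf at ha he hn ⊢
  omega

/-- For `n ≥ 2` the factor 2 suffices since log 2 > 1/2. For `n ≤ 1` the logarithm term vanishes,
and the summand 1 takes over, with equality at `n = 1`. -/
theorem sq_add_one_le (n : ℕ) : (n : ℝ) ^ 2 + 1 ≤ 2 * ((n : ℝ) ^ 2 * Real.log n + 1) := by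
  rcases Nat.lt_or_ge n 2 with h | h
  · interval_cases n <;> norm_num
  · have h2 : Real.log 2 ≤ Real.log n := Real.log_le_log (by norm_num) (by exact_mod_cast h)
    have := Real.log_two_gt_d9
    nlinarith [sq_nonneg (n : ℝ)]

end Output

end AxisCover

theorem mainTheorem4 (p : ℝ≥0∞) [Fact (1 ≤ p)] :
    ∃ (P : AxisCover.Prog) (K : ℝ), ∀ (n : ℕ) (Y : Fin n → ℝ × ℝ),
      ∃ (σ : AxisCover.Store) (t : ℕ),
        AxisCover.Exec p P (AxisCover.inputStore Y) σ t ∧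
        (t : ℝ) ≤ K * ((n : ℝ) ^ 2 * Real.log n + 1) ∧
        AxisCover.IsOptimalCover p Y σ.outCenter σ.outRadius := by
  obtain ⟨K, hK⟩ := AxisCover.time_le
  refine ⟨AxisCover.coverProg, K * 2, fun n Y => ?_⟩
  obtain ⟨σ, t, hex, ht, hopt⟩ := AxisCover.runs_coverProg (p := p) Y
  refine ⟨σ, t, hex, ?_, hopt⟩
  calc (t : ℝ) ≤ K * ((n : ℝ) ^ 2 + 1) := by exact_mod_cast ht.trans (hK n)
    _ ≤ K * (2 * ((n : ℝ) ^ 2 * Real.log n + 1)) := by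
      gcongr; exact AxisCover.sq_add_one_le n
    _ = _ := by ring
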